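/- \textbf{Game.} Let $N$ be a finite set of players; each $n\in N$ has a finite nonempty totally ordered type space $T_n$ and an action space $A_n\subset\mathbb R$ that is a nonempty finite set or a nonempty compact interval. Write $T_{-n}=\prod_{m\ne n}T_m$ and $A_{-n}=\prod_{m\neq n}A_m$, ordered componentwise. The state space is $\tilde\Omega=\prod_{k=1}^{\bar k}\tilde\Omega_k$ with the componentwise order, each $\tilde\Omega_k\subset\mathbb R$ being a nonempty finite set or a nonempty compact interval. For $n\in N$, $t_n\in T_n$, $t_{-n}\in T_{-n}$ there are a continuous payoff-utility $\tilde u_{n,t_n,t_{-n}}:A_n\times A_{-n}\times\tilde\Omega\to\mathbb R$, a probability $p_{n,t_n}=(p_{n,t_n|t_{-n}})_{t_{-n}\in T_{-n}}$ on $T_{-n}$, a set $\tilde P_{n,t_n,t_{-n}}\subseteq\mathcal P(\tilde\Omega)$ of Borel probabilities and a set $\mathcal K_{n,t_n}\subseteq\mathcal P(\tilde\Omega)^{T_{-n}}$ such that $\mathcal Q_{n,t_n}=\big(\prod_{t_{-n}}\tilde P_{n,t_n,t_{-n}}\big)\cap\mathcal K_{n,t_n}$ is nonempty. A behavioral-strategy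 profile is $\delta=(\delta_{n,t_n})$ with $\delta_{n,t_n}\in\mathcal P(A_n)$. The $(n,t_n)$-player values a family $\pi=(\pi_{t_{-n}}(\omega))_{t_{-n}\in T_{-n},\,\omega\in\tilde\Omega}$ of distributions of payoff-utility by $$s_{n,t_n}(\pi)=\sup_{\nu\in\mathcal Q_{n,t_n}}\ \sum_{t_{-n}}p_{n,t_n|t_{-n}}\int_{\tilde\Omega}\int_{\mathbb R} x\;\pi_{t_{-n}}(\omega)(dx)\;\nu_{t_{-n}}(d\omega).$$ Let $s^{a}_{n,t_n}(a_n,\delta_{-n})$ (resp. $s^{d}_{n,t_n}(d_n,\delta_{-n})$) be the value of the family where $\pi_{t_{-n}}(\omega)$ is the law of $\tilde u_{n,t_n,t_{-n}}(\cdot,\cdot,\omega)$ when the opponents' actions are drawn from $\prod_{m\ne n}\delta_{m,t_m}$ and player $n$ uses the action $a_n\in A_n$ (resp. independently draws his action from $d_n\in\mathcal P(A_n)$). The profile $\delta$ is an \emph{action-based equilibrium} if, for all $n,t_n$, $\delta_{n,t_n}$ gives probability $1$ to the set of maximizers of $s^{a}_{n,t_n}(\cdot,\delta_{-n})$ over $A_n$;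 it is a \emph{distribution-based equilibrium} if, for all $n,t_n$, $\delta_{n,t_n}$ maximizes $s^{d}_{n,t_n}(\cdot,\delta_{-n})$ over $\mathcal P(A_n)$. \textbf{Orders.} For $\mu^1,\mu^2\in\mathcal P(\tilde\Omega)$ write $\mu^1\le\mu^2$ (usual stochastic order) if $\int q\,d\mu^1\le\int q\,d\mu^2$ for every increasing measurable $q:\tilde\Omega\to\mathbb R$ integrable under both. Let $\mu^1\vee\mu^2$ and $\mu^1\wedge\mu^2$ be the least upper and greatest lower bound in $\mathcal P(\tilde\Omega)$ for this order, when they exist. For $P^1,P^2\subseteq\mathcal P(\tilde\Omega)$ write $P^1\le P^2$ if for all $\mu^1\in P^1$, $\mu^2\in P^2$ both $\mu^1\wedge\mu^2$ and $\mu^1\vee\mu^2$ exist, $\mu^1\wedge\mu^2\in P^1$ and $\mu^1\vee\mu^2\in P^2$; call $P$ a sublattice if $P\le P$. A real function $f(x,y)$ on a product of ordered sets has increasing differences between $x$ and $y$ if $f(x^2,y)-f(x^1,y)$ is increasing in $y$ whenever $x^1\le x^2$. $\mathcal M(X,Y)$ is the set of increasing maps $X\to Y$, ordered pointwise. \textbf{Assumptions.}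 (1) $\tilde u_{n,t_n,t_{-n}}(a_n,a_{-n},\tilde\omega)$ is increasing in $\tilde\omega$. (2) For each $n$ it has increasing differences between $a_n$ and $(t_n,t_{-n},a_{-n},\tilde\omega)$, and, at each fixed $a_n$, between $(t_n,t_{-n},a_{-n})$ and $\tilde\omega$. (3) $\sum_{t_{-n}}p_{n,t_n|t_{-n}}f(t_{-n})$ is increasing in $t_n$ for every increasing $f:T_{-n}\to\mathbb R$. (4) Each $\tilde P_{n,t_n,t_{-n}}$ is a sublattice. (5) $\tilde P_{n,t_n,t_{-n}}$ is increasing in $t_n$, i.e. $t_n^1\le t_n^2$ implies $\tilde P_{n,t_n^1,t_{-n}}\le\tilde P_{n,t_n^2,t_{-n}}$. (6) One of two scenarios holds. Scenario A: $p_{n,t_n}$ does not depend on $t_n$, and every $\mathcal K_{n,t_n}=\mathcal M(T_{-n},\mathcal P(\tilde\Omega))$. Scenario B: $\tilde P_{n,t_n,t_{-n}}$ does not depend on $t_{-n}$, and every $\mathcal K_{n,t_n}$ is the set of constant maps $T_{-n}\to\mathcal P(\tilde\Omega)$. \textbf{Best responses.} For $a_n\in A_n$ and $a_{-n}=(a_m)_{m\ne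 n}\in\prod_{m\ne n}\mathcal M(T_m,A_m)$ put $$\tilde s_{n,t_n}(a_n,a_{-n})=\sup_{\nu\in\mathcal Q_{n,t_n}}\sum_{t_{-n}}p_{n,t_n|t_{-n}}\int_{\tilde\Omega}\tilde u_{n,t_n,t_{-n}}\big(a_n,(a_{m}(t_m))_{m\ne n},\tilde\omega\big)\,\nu_{t_{-n}}(d\tilde\omega).$$ For $a\in\prod_n\mathcal M(T_n,A_n)$ let $\tilde{\mathcal B}(a)$ be the set of $a'\in\prod_n\mathcal M(T_n,A_n)$ such that, for all $n$ and $t_n$, $a'_n(t_n)$ maximizes $\tilde s_{n,t_n}(\cdot,a_{-n})$ over $A_n$. \textbf{Theorem.} Under (1)--(6), the set $\tilde{\mathcal E}=\{a\in\prod_{n}\mathcal M(T_n,A_n): a\in\tilde{\mathcal B}(a)\}$ of fixed points of $\tilde{\mathcal B}$, with the order induced from $\prod_n\mathcal M(T_n,A_n)$, is a nonempty complete lattice: every subset of $\tilde{\mathcal E}$ has a least upper bound and a greatest lower bound in $\tilde{\mathcal E}$. Moreover, for $a\in\prod_n\mathcal M(T_n,A_n)$, the following are equivalent: $a\in\tilde{\mathcal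 E}$; the pure profile $(\mathrm{Dirac}_{a_n(t_n)})_{n,t_n}$ is an action-based equilibrium; this pure profile is a distribution-based equilibrium. Hence pure, type-monotone equilibria exist, in both senses, and there are a smallest and a largest one. -/

import Mathlib

open MeasureTheory

noncomputable section

namespace Enterprising

/-- `f` has increasing differences between `x` and `y`. -/
def IncDiff {X Y : Type*} [Preorder X] [Preorder Y] (f : X → Y → ℝ) : Prop :=
  ∀ ⦃x₁ x₂ : X⦄, x₁ ≤ x₂ → ∀ ⦃y₁ y₂ : Y⦄, y₁ ≤ y₂ → f x₂ y₁ - f x₁ y₁ ≤ f x₂ y₂ - f x₁ y₂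

section StochasticOrder

variable {S : Type*} [MeasurableSpace S] [Preorder S]

/-- The usual stochastic order on Borel probabilities over an ordered space. -/
def StLE (μ₁ μ₂ : ProbabilityMeasure S) : Prop :=
  ∀ q : S → ℝ, Monotone q → Measurable q →
    Integrable q (μ₁ : Measure S) → Integrable q (μ₂ : Measure S) →
      ∫ x, q x ∂(μ₁ : Measure S) ≤ ∫ x, q x ∂(μ₂ : Measure S)

/-- `j` is the join (least upper bound) of `μ₁` and `μ₂` in the stochastic order on all
probabilities over `S`. -/
def IsStJoin (μ₁ μ₂ j : ProbabilityMeasure S) : Prop :=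
  StLE μ₁ j ∧ StLE μ₂ j ∧ ∀ ρ, StLE μ₁ ρ → StLE μ₂ ρ → StLE j ρ

/-- `m` is the meet (greatest lower bound) of `μ₁` and `μ₂` in the stochastic order on all
probabilities over `S`. -/
def IsStMeet (μ₁ μ₂ m : ProbabilityMeasure S) : Prop :=
  StLE m μ₁ ∧ StLE m μ₂ ∧ ∀ ρ, StLE ρ μ₁ → StLE ρ μ₂ → StLE ρ m

/-- The induced set order: for `μ₁ ∈ P₁` and `μ₂ ∈ P₂`, the meet of `μ₁` and `μ₂` lies in `P₁`
and their join lies in `P₂`. -/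
def InducedSetLE (P₁ P₂ : Set (ProbabilityMeasure S)) : Prop :=
  ∀ μ₁ ∈ P₁, ∀ μ₂ ∈ P₂,
    (∃ m ∈ P₁, IsStMeet μ₁ μ₂ m) ∧ (∃ j ∈ P₂, IsStJoin μ₁ μ₂ j)

/-- `P` is closed under pairwise meets and joins, taken among all probabilities over `S`. -/
def IsStSublattice (P : Set (ProbabilityMeasure S)) : Prop :=
  ∀ μ₁ ∈ P, ∀ μ₂ ∈ P, (∃ m ∈ P, IsStMeet μ₁ μ₂ m) ∧ (∃ j ∈ P, IsStJoin μ₁ μ₂ j)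

end StochasticOrder

/-- Opponents' type profiles. -/
abbrev OppType {ι : Type*} (T : ι → Type*) (n : ι) : Type _ := (m : {m : ι // m ≠ n}) → T m

/-- Opponents' action profiles. -/
abbrev OppAct {ι : Type*} (A : ι → Set ℝ) (n : ι) : Type _ := (m : {m : ι // m ≠ n}) → A m

/-- The state space, a product of subsets of the real line. -/
abbrev State {k : ℕ} (W : Fin k → Set ℝ) : Type := (i : Fin k) → W i

/-- A nonempty finite set or nonempty compact interval of reals. -/
def FiniteOrInterval (s : Set ℝ) : Prop :=
  s.Nonempty ∧ (s.Finite ∨ ∃ l r : ℝ, s = Set.Icc l r)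

/-- The special enterprising game with players `ι`, type spaces `T n`, action spaces `A n` and
state space `∏ i, W i`. -/
structure Game (ι : Type*) [Fintype ι] [DecidableEq ι] (T : ι → Type*) [∀ n, Fintype (T n)]
    (A : ι → Set ℝ) {k : ℕ} (W : Fin k → Set ℝ) where
  act_shape : ∀ n, FiniteOrInterval (A n)
  state_shape : ∀ i, FiniteOrInterval (W i)
  /-- payoff-utility `u n tₙ t₋ₙ aₙ a₋ₙ ω` -/
  u : (n : ι) → T n → OppType T n → A n → OppAct A n → State W → ℝ
  u_cont : ∀ n t s, Continuous fun x : A n × OppAct A n × State W => u n t s x.1 x.2.1 x.2.2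
  /-- probability that player `n` of the given type assigns to an opponent type profile -/
  p : (n : ι) → T n → OppType T n → ℝ
  p_nonneg : ∀ n t s, 0 ≤ p n t s
  p_sum : ∀ n t, ∑ s, p n t s = 1
  /-- prior sets on states, for each opponent type profile -/
  prior : (n : ι) → T n → OppType T n → Set (ProbabilityMeasure (State W))
  /-- joint restriction on the vector of priors -/
  K : (n : ι) → T n → Set (OppType T n → ProbabilityMeasure (State W))
  prior_nonempty : ∀ n t, {ν | (∀ s, ν s ∈ prior n t s) ∧ ν ∈ K n t}.Nonempty

namespace Game

variable {ι : Type*} [Fintype ι] [DecidableEq ι] {T : ι → Type*} [∀ n, Fintype (T n)]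
  {A : ι → Set ℝ} {k : ℕ} {W : Fin k → Set ℝ}

/-- The set of admissible prior vectors of player `n` with type `t`. -/
def Q (G : Game ι T A W) (n : ι) (t : T n) : Set (OppType T n → ProbabilityMeasure (State W)) :=
  {ν | (∀ s, ν s ∈ G.prior n t s) ∧ ν ∈ G.K n t}

/-! ### Behavioral strategies and equilibria -/

/-- Satisfaction of a vector `π` of payoff distributions, indexed by opponents' types and states:
the most favorable expectation over the admissible priors `p n t × ν`, `ν ∈ Q n t`. -/
def satisfaction (G : Game ι T A W) (n : ι) (t : T n)
    (π : OppType T n → State W → Measure ℝ) : ℝ :=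
  ⨆ ν : G.Q n t, ∑ s, G.p n t s *
    ∫ ω, (∫ x, x ∂(π s ω)) ∂(ν.1 s : Measure (State W))

/-- Payoff distributions when player `n` takes the action `a` and the opponents randomize. -/
def payoffAct (G : Game ι T A W) (n : ι) (t : T n) (a : A n)
    (δ : (m : {m : ι // m ≠ n}) → T m → ProbabilityMeasure (A m)) :
    OppType T n → State W → Measure ℝ := fun s ω =>
  (Measure.pi fun m : {m : ι // m ≠ n} => (δ m (s m) : Measure (A m))).map fun b => G.u n t s a b ω

/-- Payoff distributions when player `n` and the opponents all randomize. -/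
def payoffDist (G : Game ι T A W) (n : ι) (t : T n) (d : ProbabilityMeasure (A n))
    (δ : (m : {m : ι // m ≠ n}) → T m → ProbabilityMeasure (A m)) :
    OppType T n → State W → Measure ℝ := fun s ω =>
  ((d : Measure (A n)).prod (Measure.pi fun m : {m : ι // m ≠ n} => (δ m (s m) : Measure (A m)))).map
    fun x => G.u n t s x.1 x.2 ω

/-- Action-based equilibrium: every type of every player puts full mass on optimal actions. -/
def IsActionEquilibrium (G : Game ι T A W) (δ : (n : ι) → T n → ProbabilityMeasure (A n)) :
    Prop :=
  ∀ (n : ι) (t : T n), (δ n t : Measure (A n))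
    {a | ∀ a' : A n, G.satisfaction n t (G.payoffAct n t a' fun m => δ m) ≤
      G.satisfaction n t (G.payoffAct n t a fun m => δ m)} = 1

/-- Distribution-based equilibrium: every type of every player uses an optimal distribution. -/
def IsDistEquilibrium (G : Game ι T A W) (δ : (n : ι) → T n → ProbabilityMeasure (A n)) :
    Prop :=
  ∀ (n : ι) (t : T n) (d : ProbabilityMeasure (A n)),
    G.satisfaction n t (G.payoffDist n t d fun m => δ m) ≤
      G.satisfaction n t (G.payoffDist n t (δ n t) fun m => δ m)

/-- The pure behavioral-strategy profile given by type-to-action maps. -/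
def pure {ι : Type*} {T : ι → Type*} {A : ι → Set ℝ} (a : (n : ι) → T n → A n) :
    (n : ι) → T n → ProbabilityMeasure (A n) :=
  fun n t => ⟨Measure.dirac (a n t), inferInstance⟩

/-! ### The monotone best-response correspondence -/

/-- Expected payoff-utility under the state distribution `μ`. -/
def v (G : Game ι T A W) (n : ι) (t : T n) (s : OppType T n) (a : A n) (b : OppAct A n)
    (μ : ProbabilityMeasure (State W)) : ℝ :=
  ∫ ω, G.u n t s a b ω ∂(μ : Measure (State W))

/-- Expected payoff-utility under the prior vector `ν`, when opponents follow `α`. -/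
def w (G : Game ι T A W) (n : ι) (t : T n) (a : A n)
    (α : (m : {m : ι // m ≠ n}) → T m → A m)
    (ν : OppType T n → ProbabilityMeasure (State W)) : ℝ :=
  ∑ s, G.p n t s * G.v n t s a (fun m => α m (s m)) (ν s)

/-- Optimistic payoff of the action `a` against pure opponent strategies `α`. -/
def optPayoff (G : Game ι T A W) (n : ι) (t : T n) (a : A n)
    (α : (m : {m : ι // m ≠ n}) → T m → A m) : ℝ :=
  ⨆ ν : G.Q n t, G.w n t a α ν.1

/-- Best-response actions of player `n` with type `t`. -/
def bestAct (G : Game ι T A W) (n : ι) (t : T n)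
    (α : (m : {m : ι // m ≠ n}) → T m → A m) : Set (A n) :=
  {a | ∀ a' : A n, G.optPayoff n t a' α ≤ G.optPayoff n t a α}

variable [∀ n, LinearOrder (T n)]

/-- Monotone best responses of player `n` to monotone strategies of the opponents. -/
def bestResp (G : Game ι T A W) (n : ι) (α : (m : {m : ι // m ≠ n}) → T m →o A m) :
    Set (T n →o A n) :=
  {b | ∀ t, b t ∈ G.bestAct n t fun m => α m}

/-- The monotone best-response correspondence on profiles of monotone strategies. -/
def bestRespProfile (G : Game ι T A W) (a : (n : ι) → T n →o A n) :
    Set ((n : ι) → T n →o A n) :=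
  {a' | ∀ n, a' n ∈ G.bestResp n fun m => a m}

/-- Fixed points of the monotone best-response correspondence. -/
def fixedPoints (G : Game ι T A W) : Set ((n : ι) → T n →o A n) :=
  {a | a ∈ G.bestRespProfile a}

/-! ### Strategic complementarities -/

/-- The monotonicity assumptions on the primitives of the game. -/
structure StrategicComplementarities (G : Game ι T A W) : Prop where
  mono_state : ∀ n t s a b, Monotone (G.u n t s a b)
  incDiff_own : ∀ n, IncDiff fun (a : A n) (y : T n × OppType T n × OppAct A n × State W) =>
    G.u n y.1 y.2.1 a y.2.2.1 y.2.2.2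
  incDiff_state : ∀ n (a : A n),
    IncDiff fun (y : T n × OppType T n × OppAct A n) (ω : State W) => G.u n y.1 y.2.1 a y.2.2 ω
  mono_prob : ∀ n (t₁ t₂ : T n), t₁ ≤ t₂ → ∀ f : OppType T n → ℝ, Monotone f →
    ∑ s, G.p n t₁ s * f s ≤ ∑ s, G.p n t₂ s * f s
  prior_sublattice : ∀ n t s, IsStSublattice (G.prior n t s)
  mono_prior : ∀ n (t₁ t₂ : T n) s, t₁ ≤ t₂ → InducedSetLE (G.prior n t₁ s) (G.prior n t₂ s)

/-- Scenario A: beliefs on opponents' types do not depend on one's own type, and the prior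
vectors are the monotone ones. -/
def ScenarioA (G : Game ι T A W) : Prop :=
  (∀ n (t₁ t₂ : T n), G.p n t₁ = G.p n t₂) ∧
  ∀ n t, G.K n t = {ν | ∀ s₁ s₂ : OppType T n, s₁ ≤ s₂ → StLE (ν s₁) (ν s₂)}

/-- Scenario B: prior sets do not depend on opponents' types, and the prior vectors are the
constant ones. -/
def ScenarioB (G : Game ι T A W) : Prop :=
  (∀ n t (s₁ s₂ : OppType T n), G.prior n t s₁ = G.prior n t s₂) ∧
  ∀ n t, G.K n t = {ν | ∃ μ, ν = fun _ => μ}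

end Game

end Enterprising

end

/-!
A player who evaluates actions by the supremum over a family of priors still has best responses
with strategic complementarities, provided the priors are monotone in the opponents' types and any
prior of a lower type and any prior of a higher type are dominated by a third prior of the higher
type. Given `ν₁` for the lower type and `ν₂` for the higher one, pass to the dominating `ν`: moving
from `ν₁` to `ν` raises the gain of a larger action, and moving from `ν₂` to `ν` raises the payoff,
so the suprema inherit increasing differences. By Topkis' argument best-response sets then increase
in the strong set order, and Zhou's fixed-point theorem, applied to the correspondence of monotone
best responses, makes the fixed points a complete lattice. By Fubini, the value of a mixed action
never exceeds the largest value of a pure one, so for pure type-monotone profiles both notions of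
equilibrium amount to being such a fixed point.
-/

namespace Enterprising

section StrongSetOrder

/-- The strong (Veinott) set order on subsets of a lattice, in which best-response sets increase. -/
def StrongSetLE {X : Type*} [Lattice X] (s t : Set X) : Prop :=
  ∀ a ∈ s, ∀ b ∈ t, a ⊓ b ∈ s ∧ a ⊔ b ∈ t

/-- Nonempty subcomplete subsets: bounds are computed in `X` and are only required of nonempty
subsets of `s`, so `s` need not contain the least or greatest element of `X`. -/
structure IsSubcomplete {X : Type*} [Preorder X] (s : Set X) : Prop where
  nonempty : s.Nonempty
  exists_isLUB : ∀ u ⊆ s, u.Nonempty → ∃ x ∈ s, IsLUB u x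
  exists_isGLB : ∀ u ⊆ s, u.Nonempty → ∃ x ∈ s, IsGLB u x

theorem IsSubcomplete.exists_isGreatest {X : Type*} [Preorder X] {s : Set X}
    (hs : IsSubcomplete s) : ∃ m, IsGreatest s m := by
  obtain ⟨m, hm, hlub⟩ := hs.exists_isLUB s subset_rfl hs.nonempty
  exact ⟨m, hm, hlub.1⟩

theorem StrongSetLE.le_of_isGreatest {X : Type*} [Lattice X] {s t : Set X} {a m : X}
    (h : StrongSetLE s t) (ha : a ∈ s) (hm : IsGreatest t m) : a ≤ m :=
  le_sup_left.trans (hm.2 (h a ha m hm.1).2)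

section Pi

variable {ι : Type*} {X : ι → Type*}

theorem StrongSetLE.pi [∀ i, Lattice (X i)] {s t : ∀ i, Set (X i)}
    (h : ∀ i, StrongSetLE (s i) (t i)) : StrongSetLE (Set.univ.pi s) (Set.univ.pi t) :=
  fun _ ha _ hb => ⟨fun i hi => (h i _ (ha i hi) _ (hb i hi)).1,
    fun i hi => (h i _ (ha i hi) _ (hb i hi)).2⟩

theorem IsSubcomplete.pi [∀ i, Preorder (X i)] {s : ∀ i, Set (X i)}
    (h : ∀ i, IsSubcomplete (s i)) : IsSubcomplete (Set.univ.pi s) where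
  nonempty := Set.univ_pi_nonempty_iff.2 fun i => (h i).nonempty
  exists_isLUB u hu hne := by
    choose x hx hlub using fun i => (h i).exists_isLUB (Function.eval i '' u)
      (Set.image_subset_iff.2 fun f hf => hu hf i trivial) (hne.image _)
    exact ⟨x, fun i _ => hx i, isLUB_pi.2 hlub⟩
  exists_isGLB u hu hne := by
    choose x hx hglb using fun i => (h i).exists_isGLB (Function.eval i '' u)
      (Set.image_subset_iff.2 fun f hf => hu hf i trivial) (hne.image _)
    exact ⟨x, fun i _ => hx i, isGLB_pi.2 hglb⟩

end Pi

section MonotoneSelections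

variable {T X : Type*} [Preorder T]

/-- The monotone selections of a correspondence, such as the type-monotone best responses of a
player. -/
def monotoneSelections [Preorder X] (β : T → Set X) : Set (T →o X) :=
  {f | ∀ t, f t ∈ β t}

theorem exists_orderHom_isLUB [Preorder X] {S : Set (T →o X)} {g : T → X}
    (hg : ∀ t, IsLUB ((fun f : T →o X => f t) '' S) (g t)) :
    ∃ f : T →o X, ⇑f = g ∧ IsLUB S f := by
  have hmono : Monotone g := fun t₁ t₂ ht => (hg t₁).2 <| Set.forall_mem_image.2 fun f hf =>
    (f.monotone ht).trans ((hg t₂).1 ⟨f, hf, rfl⟩)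
  refine ⟨⟨g, hmono⟩, rfl, fun f hf t => (hg t).1 ⟨f, hf, rfl⟩, fun f hf t => (hg t).2 ?_⟩
  exact Set.forall_mem_image.2 fun e he => hf he t

theorem exists_orderHom_isGLB [Preorder X] {S : Set (T →o X)} {g : T → X}
    (hg : ∀ t, IsGLB ((fun f : T →o X => f t) '' S) (g t)) :
    ∃ f : T →o X, ⇑f = g ∧ IsGLB S f := by
  have hmono : Monotone g := fun t₁ t₂ ht => (hg t₂).2 <| Set.forall_mem_image.2 fun f hf =>
    ((hg t₁).1 ⟨f, hf, rfl⟩).trans (f.monotone ht)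
  refine ⟨⟨g, hmono⟩, rfl, fun f hf t => (hg t).1 ⟨f, hf, rfl⟩, fun f hf t => (hg t).2 ?_⟩
  exact Set.forall_mem_image.2 fun e he => hf he t

theorem StrongSetLE.monotoneSelections [Lattice X] {β γ : T → Set X}
    (h : ∀ t, StrongSetLE (β t) (γ t)) :
    StrongSetLE (monotoneSelections β) (monotoneSelections γ) :=
  fun _ hf _ hg => ⟨fun t => (h t _ (hf t) _ (hg t)).1, fun t => (h t _ (hf t) _ (hg t)).2⟩

theorem IsSubcomplete.monotoneSelections [Lattice X] {β : T → Set X}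
    (hβ : ∀ t, IsSubcomplete (β t)) (hmono : ∀ ⦃t₁ t₂⦄, t₁ ≤ t₂ → StrongSetLE (β t₁) (β t₂)) :
    IsSubcomplete (monotoneSelections β) where
  nonempty := by
    choose m hm using fun t => (hβ t).exists_isGreatest
    exact ⟨⟨m, fun t₁ t₂ ht => (hmono ht).le_of_isGreatest (hm t₁).1 (hm t₂)⟩, fun t => (hm t).1⟩
  exists_isLUB u hu hne := by
    choose g hg hlub using fun t => (hβ t).exists_isLUB ((fun f : T →o X => f t) '' u)
      (Set.image_subset_iff.2 fun f hf => hu hf t) (hne.image _)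
    obtain ⟨f, rfl, hf⟩ := exists_orderHom_isLUB hlub
    exact ⟨f, hg, hf⟩
  exists_isGLB u hu hne := by
    choose g hg hglb using fun t => (hβ t).exists_isGLB ((fun f : T →o X => f t) '' u)
      (Set.image_subset_iff.2 fun f hf => hu hf t) (hne.image _)
    obtain ⟨f, rfl, hf⟩ := exists_orderHom_isGLB hglb
    exact ⟨f, hg, hf⟩

end MonotoneSelections

section Compact

variable {X : Type*} [LinearOrder X] [TopologicalSpace X] [OrderClosedTopology X] [CompactSpace X]

theorem exists_mem_closure_isLUB {s : Set X} (hs : s.Nonempty) : ∃ x ∈ closure s, IsLUB s x := by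
  obtain ⟨x, hx⟩ := isClosed_closure.isCompact.exists_isGreatest hs.closure
  refine ⟨x, hx.1, fun y hy => hx.2 (subset_closure hy), fun y hy => ?_⟩
  exact closure_minimal hy isClosed_Iic hx.1

theorem exists_mem_closure_isGLB {s : Set X} (hs : s.Nonempty) : ∃ x ∈ closure s, IsGLB s x := by
  obtain ⟨x, hx⟩ := isClosed_closure.isCompact.exists_isLeast hs.closure
  refine ⟨x, hx.1, fun y hy => hx.2 (subset_closure hy), fun y hy => ?_⟩
  exact closure_minimal hy isClosed_Ici hx.1

theorem isSubcomplete_of_isClosed {s : Set X} (hs : IsClosed s) (hne : s.Nonempty) :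
    IsSubcomplete s where
  nonempty := hne
  exists_isLUB _ hu hune :=
    let ⟨x, hx, hlub⟩ := exists_mem_closure_isLUB hune
    ⟨x, closure_minimal hu hs hx, hlub⟩
  exists_isGLB _ hu hune :=
    let ⟨x, hx, hglb⟩ := exists_mem_closure_isGLB hune
    ⟨x, closure_minimal hu hs hx, hglb⟩

end Compact

end StrongSetOrder

section FixedPoints

theorem IsSubcomplete.exists_isLUB_of_univ {X : Type*} [Preorder X]
    (hX : IsSubcomplete (Set.univ : Set X)) (S : Set X) : ∃ x, IsLUB S x := by
  rcases S.eq_empty_or_nonempty with rfl | hS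
  · obtain ⟨x, -, hx⟩ := hX.exists_isGLB Set.univ subset_rfl hX.nonempty
    exact ⟨x, isLUB_empty_iff.2 fun y => hx.1 trivial⟩
  · obtain ⟨x, -, hx⟩ := hX.exists_isLUB S (Set.subset_univ S) hS
    exact ⟨x, hx⟩

/-- The complete lattice structure carried by a lattice that is subcomplete in itself, for use in
fixed-point theorems. It keeps the given lattice operations definitionally. -/
noncomputable abbrev IsSubcomplete.completeLattice {X : Type*} [Lattice X]
    (hX : IsSubcomplete (Set.univ : Set X)) : CompleteLattice X :=
  letI : SupSet X := ⟨fun S => (hX.exists_isLUB_of_univ S).choose⟩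
  { ‹Lattice X›, completeLatticeOfSup X fun S => (hX.exists_isLUB_of_univ S).choose_spec with }

variable {X : Type*} [CompleteLattice X]

theorem IsSubcomplete.sInf_mem {s u : Set X} (hs : IsSubcomplete s) (hu : u ⊆ s)
    (hne : u.Nonempty) : sInf u ∈ s := by
  obtain ⟨x, hx, hglb⟩ := hs.exists_isGLB u hu hne
  rwa [hglb.sInf_eq]

theorem exists_isLUB_fixedPoints {F : X → Set X} (hmono : ∀ ⦃x y⦄, x ≤ y → StrongSetLE (F x) (F y))
    (hF : ∀ x, IsSubcomplete (F x)) (S : Set {x | x ∈ F x}) : ∃ x, IsLUB S x := by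
  set b : X := sSup (Subtype.val '' S)
  have le_b : ∀ e ∈ S, e.1 ≤ b := fun e he => le_sSup (Set.mem_image_of_mem _ he)
  have hne : ∀ x, (F (x ⊔ b) ∩ Set.Ici b).Nonempty := by
    intro x
    obtain ⟨m, hm⟩ := (hF (x ⊔ b)).exists_isGreatest
    refine ⟨m, hm.1, sSup_le <| Set.forall_mem_image.2 fun e he => ?_⟩
    exact (hmono ((le_b e he).trans le_sup_right)).le_of_isGreatest e.2 hm
  let m : X → X := fun x => sInf (F (x ⊔ b) ∩ Set.Ici b)
  have m_mem : ∀ x, m x ∈ F (x ⊔ b) := fun x => (hF _).sInf_mem Set.inter_subset_left (hne x)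
  have b_le : ∀ x, b ≤ m x := fun x => le_sInf fun y hy => hy.2
  have m_mono : Monotone m := by
    intro x y hxy
    have hinf : m x ⊓ m y ∈ F (x ⊔ b) :=
      (hmono (sup_le_sup_right hxy b) _ (m_mem x) _ (m_mem y)).1
    have hle : m x ≤ m x ⊓ m y := sInf_le ⟨hinf, le_inf (b_le x) (b_le y)⟩
    exact hle.trans inf_le_right
  -- The least fixed point of `g` is the supremum of `S` among the fixed points of `F`.
  let g : X →o X := ⟨m, m_mono⟩
  have hfix : m g.lfp = g.lfp := g.map_lfp
  have b_le_lfp : b ≤ g.lfp := (b_le g.lfp).trans_eq hfix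
  have lfp_mem : g.lfp ∈ F g.lfp := by
    have h := m_mem g.lfp
    rwa [hfix, sup_eq_left.2 b_le_lfp] at h
  refine ⟨⟨g.lfp, lfp_mem⟩, fun e he => (le_b e he).trans b_le_lfp, fun e he => ?_⟩
  have b_le_e : b ≤ e.1 := sSup_le <| Set.forall_mem_image.2 fun e' he' => he he'
  refine g.lfp_le (sInf_le ⟨?_, b_le_e⟩)
  rw [sup_eq_left.2 b_le_e]
  exact e.2

end FixedPoints

section Argmax

/-- The set of global maximizers of a payoff. -/
def argmax {X : Type*} (f : X → ℝ) : Set X :=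
  {x | ∀ x', f x' ≤ f x}

theorem IncDiff.strongSetLE_argmax {X Y : Type*} [LinearOrder X] [Preorder Y] {f : X → Y → ℝ}
    (hf : IncDiff f) {y₁ y₂ : Y} (hy : y₁ ≤ y₂) :
    StrongSetLE (argmax fun x => f x y₁) (argmax fun x => f x y₂) := by
  intro x₁ h₁ x₂ h₂
  rcases le_total x₁ x₂ with h | h
  · rw [inf_eq_left.2 h, sup_eq_right.2 h]
    exact ⟨h₁, h₂⟩
  · rw [inf_eq_right.2 h, sup_eq_left.2 h]
    have hdiff : f x₁ y₁ - f x₂ y₁ ≤ f x₁ y₂ - f x₂ y₂ := hf h hy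
    exact ⟨fun x => (h₁ x).trans (by linarith [h₂ x₁]), fun x => (h₂ x).trans (by linarith [h₁ x₂])⟩

theorem isSubcomplete_argmax {X : Type*} [LinearOrder X] [TopologicalSpace X]
    [OrderClosedTopology X] [CompactSpace X] [Nonempty X] {f : X → ℝ} (hf : Continuous f) :
    IsSubcomplete (argmax f) := by
  refine isSubcomplete_of_isClosed ?_ ?_
  · simp only [argmax, Set.ofPred_forall]
    exact isClosed_iInter fun x' => isClosed_le continuous_const hf
  · obtain ⟨x, -, hx⟩ := isCompact_univ.exists_isMaxOn Set.univ_nonempty hf.continuousOn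
    exact ⟨x, fun x' => hx (Set.mem_univ x')⟩

theorem incDiff_iSup {X Y N : Type*} [Preorder X] [Preorder Y] {Q : Y → Set N}
    {w : X → Y → N → ℝ} (hQ : ∀ y, (Q y).Nonempty)
    (hbdd : ∀ x y, BddAbove (Set.range fun ν : Q y => w x y ν))
    (hw : ∀ ⦃x₁ x₂⦄, x₁ ≤ x₂ → ∀ ⦃y₁ y₂⦄, y₁ ≤ y₂ → ∀ ν₁ ∈ Q y₁, ∀ ν₂ ∈ Q y₂, ∃ ν ∈ Q y₂,
      w x₂ y₁ ν₁ - w x₁ y₁ ν₁ ≤ w x₂ y₂ ν - w x₁ y₂ ν ∧ w x₁ y₂ ν₂ ≤ w x₁ y₂ ν) :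
    IncDiff fun x y => ⨆ ν : Q y, w x y ν := by
  intro x₁ x₂ hx y₁ y₂ hy
  have : ∀ y, Nonempty (Q y) := fun y => (hQ y).to_subtype
  suffices h : ∀ (ν₁ : Q y₁) (ν₂ : Q y₂), w x₂ y₁ ν₁ + w x₁ y₂ ν₂ ≤
      (⨆ ν : Q y₁, w x₁ y₁ ν) + ⨆ ν : Q y₂, w x₂ y₂ ν by
    have h₁ : ∀ ν₂ : Q y₂, (⨆ ν : Q y₁, w x₂ y₁ ν) ≤
        (⨆ ν : Q y₁, w x₁ y₁ ν) + (⨆ ν : Q y₂, w x₂ y₂ ν) - w x₁ y₂ ν₂ := fun ν₂ =>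
      ciSup_le fun ν₁ => le_sub_iff_add_le.2 (h ν₁ ν₂)
    have h₂ : (⨆ ν : Q y₂, w x₁ y₂ ν) ≤
        (⨆ ν : Q y₁, w x₁ y₁ ν) + (⨆ ν : Q y₂, w x₂ y₂ ν) - ⨆ ν : Q y₁, w x₂ y₁ ν :=
      ciSup_le fun ν₂ => le_sub_comm.1 (h₁ ν₂)
    linarith
  intro ν₁ ν₂
  obtain ⟨ν, hν, hdiff, hle⟩ := hw hx hy ν₁ ν₁.2 ν₂ ν₂.2
  linarith [le_ciSup (hbdd x₁ y₁) ν₁, le_ciSup (hbdd x₂ y₂) ⟨ν, hν⟩]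

end Argmax

section StochasticOrder

variable {S : Type*} [MeasurableSpace S] [Preorder S] {μ₁ μ₂ μ₃ : ProbabilityMeasure S}

theorem StLE.refl (μ : ProbabilityMeasure S) : StLE μ μ := fun _ _ _ _ _ => le_rfl

/-- A test function integrable under `μ₁` and `μ₃` need not be integrable under `μ₂`, so it is first
truncated. -/
theorem StLE.trans (h₁₂ : StLE μ₁ μ₂) (h₂₃ : StLE μ₂ μ₃) : StLE μ₁ μ₃ := by
  intro q hq hqm hq₁ hq₃
  let trunc : ℕ → S → ℝ := fun N x => max (-N) (min (q x) N)
  have htrunc_meas : ∀ N, Measurable (trunc N) := fun N =>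
    measurable_const.max (hqm.min measurable_const)
  have htrunc_mono : ∀ N, Monotone (trunc N) := fun N x y hxy =>
    max_le_max le_rfl (min_le_min (hq hxy) le_rfl)
  have htrunc_int : ∀ N (μ : ProbabilityMeasure S), Integrable (trunc N) (μ : Measure S) :=
    fun N μ => Integrable.of_mem_Icc (-N) N (htrunc_meas N).aemeasurable <|
      Filter.Eventually.of_forall fun x =>
        ⟨le_max_left _ _, max_le (by linarith [N.cast_nonneg (α := ℝ)]) (min_le_right _ _)⟩
  have habs : ∀ N x, ‖trunc N x‖ ≤ ‖q x‖ := by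
    intro N x
    have hN : (0 : ℝ) ≤ N := N.cast_nonneg
    simp only [trunc, Real.norm_eq_abs]
    grind
  have hlim : ∀ x, Filter.Tendsto (fun N => trunc N x) Filter.atTop (nhds (q x)) := by
    intro x
    obtain ⟨N₀, hN₀⟩ := exists_nat_ge |q x|
    refine tendsto_const_nhds.congr' ?_
    filter_upwards [Filter.eventually_ge_atTop N₀] with N hN
    have hqN : |q x| ≤ N := hN₀.trans (Nat.cast_le.2 hN)
    change q x = max (-(N : ℝ)) (min (q x) N)
    rw [min_eq_left (abs_le.1 hqN).2, max_eq_right (abs_le.1 hqN).1]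
  have htendsto : ∀ {μ : ProbabilityMeasure S}, Integrable q (μ : Measure S) →
      Filter.Tendsto (fun N => ∫ x, trunc N x ∂(μ : Measure S)) Filter.atTop
        (nhds (∫ x, q x ∂(μ : Measure S))) := fun hint =>
    tendsto_integral_of_dominated_convergence _ (fun N => (htrunc_meas N).aestronglyMeasurable)
      hint.norm (fun N => Filter.Eventually.of_forall (habs N)) (Filter.Eventually.of_forall hlim)
  refine le_of_tendsto_of_tendsto' (htendsto hq₁) (htendsto hq₃) fun N => ?_
  exact (h₁₂ _ (htrunc_mono N) (htrunc_meas N) (htrunc_int N μ₁) (htrunc_int N μ₂)).trans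
    (h₂₃ _ (htrunc_mono N) (htrunc_meas N) (htrunc_int N μ₂) (htrunc_int N μ₃))

end StochasticOrder

section Expectation

theorem integrable_of_continuous {Ω : Type*} [TopologicalSpace Ω] [CompactSpace Ω]
    [MeasurableSpace Ω] [OpensMeasurableSpace Ω] {f : Ω → ℝ} (hf : Continuous f) (μ : Measure Ω)
    [IsFiniteMeasure μ] : Integrable f μ :=
  hf.integrable_of_hasCompactSupport (HasCompactSupport.of_compactSpace f)

theorem StLE.integral_le_integral {Ω : Type*} [TopologicalSpace Ω] [CompactSpace Ω]
    [MeasurableSpace Ω] [OpensMeasurableSpace Ω] [Preorder Ω] {μ₁ μ₂ : ProbabilityMeasure Ω}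
    (h : StLE μ₁ μ₂) {f₁ f₂ : Ω → ℝ} (hmono : Monotone f₁) (hle : f₁ ≤ f₂)
    (hf₁ : Continuous f₁) (hf₂ : Continuous f₂) :
    ∫ ω, f₁ ω ∂(μ₁ : Measure Ω) ≤ ∫ ω, f₂ ω ∂(μ₂ : Measure Ω) :=
  (h f₁ hmono hf₁.measurable (integrable_of_continuous hf₁ _)
    (integrable_of_continuous hf₁ _)).trans
    (integral_mono (integrable_of_continuous hf₁ _) (integrable_of_continuous hf₂ _) hle)

variable {σ Ω : Type*} [Fintype σ] [MeasurableSpace Ω]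

/-- The expectation of `f` when `s` has probability `p s` and the state, given `s`, has law `ν s`.
-/
noncomputable def expectation (p : σ → ℝ) (ν : σ → ProbabilityMeasure Ω) (f : σ → Ω → ℝ) : ℝ :=
  ∑ s, p s * ∫ ω, f s ω ∂(ν s : Measure Ω)

/-- The optimistic expectation over the priors in `Q`. It is the common form of
`Game.satisfaction` and `Game.optPayoff`. -/
noncomputable def upperExpectation (p : σ → ℝ) (Q : Set (σ → ProbabilityMeasure Ω))
    (f : σ → Ω → ℝ) : ℝ :=
  ⨆ ν : Q, expectation p ν.1 f

variable [TopologicalSpace Ω] [CompactSpace Ω] [OpensMeasurableSpace Ω] {p p₁ p₂ : σ → ℝ}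
  {Q : Set (σ → ProbabilityMeasure Ω)} {ν ν₁ ν₂ : σ → ProbabilityMeasure Ω}

theorem expectation_sub {f g : σ → Ω → ℝ} (hf : ∀ s, Continuous (f s))
    (hg : ∀ s, Continuous (g s)) :
    expectation p ν (f - g) = expectation p ν f - expectation p ν g := by
  simp only [expectation, ← Finset.sum_sub_distrib, ← mul_sub, Pi.sub_apply]
  exact Finset.sum_congr rfl fun s _ => congrArg (p s * ·) <|
    integral_sub (integrable_of_continuous (hf s) _) (integrable_of_continuous (hg s) _)

section Order

variable [Preorder Ω]

theorem expectation_mono_prior (hp : 0 ≤ p) (hν : ∀ s, StLE (ν₁ s) (ν₂ s)) {f₁ f₂ : σ → Ω → ℝ}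
    (hmono : ∀ s, Monotone (f₁ s)) (hle : f₁ ≤ f₂) (hf₁ : ∀ s, Continuous (f₁ s))
    (hf₂ : ∀ s, Continuous (f₂ s)) : expectation p ν₁ f₁ ≤ expectation p ν₂ f₂ :=
  Finset.sum_le_sum fun s _ => mul_le_mul_of_nonneg_left
    ((hν s).integral_le_integral (hmono s) (hle s) (hf₁ s) (hf₂ s)) (hp s)

theorem expectation_mono_weight [Preorder σ]
    (hp : ∀ φ : σ → ℝ, Monotone φ → ∑ s, p₁ s * φ s ≤ ∑ s, p₂ s * φ s)
    (hν : ∀ ⦃s₁ s₂⦄, s₁ ≤ s₂ → StLE (ν s₁) (ν s₂)) {f : σ → Ω → ℝ}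
    (hmono : Monotone fun x : σ × Ω => f x.1 x.2) (hf : ∀ s, Continuous (f s)) :
    expectation p₁ ν f ≤ expectation p₂ ν f :=
  hp _ fun s₁ s₂ hs => (hν hs).integral_le_integral
    (fun ω ω' hω => hmono (show (s₁, ω) ≤ (s₁, ω') from ⟨le_rfl, hω⟩))
    (fun ω => hmono (show (s₁, ω) ≤ (s₂, ω) from ⟨hs, le_rfl⟩)) (hf s₁) (hf s₂)

end Order

theorem expectation_le_add_dist (hp : p ∈ stdSimplex ℝ σ) (f g : σ → C(Ω, ℝ)) :
    expectation p ν (fun s => f s) ≤ expectation p ν (fun s => g s) + dist f g := by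
  have hpoint : ∀ s ω, f s ω - g s ω ≤ dist f g := fun s ω =>
    (le_abs_self _).trans ((ContinuousMap.dist_apply_le_dist ω).trans (dist_le_pi_dist f g s))
  have hint : ∀ s, ∫ ω, (f s ω - g s ω) ∂(ν s : Measure Ω) ≤ dist f g := fun s =>
    (integral_mono (integrable_of_continuous ((f s).continuous.sub (g s).continuous) _)
      (integrable_const _) (hpoint s)).trans_eq (by simp)
  rw [← sub_le_iff_le_add', ← expectation_sub (fun s => (f s).continuous) fun s => (g s).continuous]
  calc expectation p ν ((fun s => ⇑(f s)) - fun s => ⇑(g s))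
      ≤ ∑ s, p s * dist f g := Finset.sum_le_sum fun s _ =>
        mul_le_mul_of_nonneg_left (hint s) (hp.1 s)
    _ = dist f g := by rw [← Finset.sum_mul, hp.2, one_mul]

theorem bddAbove_expectation (hp : p ∈ stdSimplex ℝ σ) {f : σ → Ω → ℝ}
    (hf : ∀ s, Continuous (f s)) : BddAbove (Set.range fun ν : Q => expectation p ν.1 f) := by
  let F : σ → C(Ω, ℝ) := fun s => ⟨f s, hf s⟩
  refine ⟨dist F 0, Set.forall_mem_range.2 fun ν => ?_⟩
  exact (expectation_le_add_dist hp F 0).trans_eq (by simp [expectation])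

theorem expectation_le_upperExpectation (hp : p ∈ stdSimplex ℝ σ) {f : σ → Ω → ℝ}
    (hf : ∀ s, Continuous (f s)) (hν : ν ∈ Q) : expectation p ν f ≤ upperExpectation p Q f :=
  le_ciSup (bddAbove_expectation hp hf) ⟨ν, hν⟩

theorem lipschitzWith_upperExpectation (hp : p ∈ stdSimplex ℝ σ) (hQ : Q.Nonempty) :
    LipschitzWith 1 fun f : σ → C(Ω, ℝ) => upperExpectation p Q fun s => f s := by
  have := hQ.to_subtype
  refine LipschitzWith.of_le_add fun f g => ciSup_le fun ν => ?_
  exact (expectation_le_add_dist hp f g).trans (add_le_add_left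
    (expectation_le_upperExpectation hp (fun s => (g s).continuous) ν.2) _)

theorem continuous_upperExpectation {X : Type*} [TopologicalSpace X] (hp : p ∈ stdSimplex ℝ σ)
    (hQ : Q.Nonempty) {F : X → σ → Ω → ℝ} (hF : ∀ s, Continuous fun z : X × Ω => F z.1 s z.2) :
    Continuous fun x => upperExpectation p Q (F x) := by
  let f : X → σ → C(Ω, ℝ) := fun x s => ⟨F x s, (hF s).comp (Continuous.prodMk_right x)⟩
  have hf : Continuous f := continuous_pi fun s =>
    ContinuousMap.continuous_of_continuous_uncurry _ (hF s)
  exact (lipschitzWith_upperExpectation hp hQ).continuous.comp hf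

section Mixture

variable {X : Type*} [TopologicalSpace X] [CompactSpace X] [MeasurableSpace X]
  [OpensMeasurableSpace X] [SecondCountableTopologyEither X Ω] {d : Measure X}
  [IsProbabilityMeasure d] {F : X → σ → Ω → ℝ}

theorem expectation_integral_le (hF : ∀ s, Continuous fun z : X × Ω => F z.1 s z.2) {c : ℝ}
    (hc : ∀ x, expectation p ν (F x) ≤ c) :
    expectation p ν (fun s ω => ∫ x, F x s ω ∂d) ≤ c := by
  have hint : ∀ s, Integrable (fun z : X × Ω => F z.1 s z.2) (d.prod (ν s : Measure Ω)) :=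
    fun s => integrable_of_continuous (hF s) _
  have hterm : ∀ s, Integrable (fun x => p s * ∫ ω, F x s ω ∂(ν s : Measure Ω)) d := fun s =>
    (hint s).integral_prod_left.const_mul _
  calc expectation p ν (fun s ω => ∫ x, F x s ω ∂d)
      = ∑ s, ∫ x, p s * ∫ ω, F x s ω ∂(ν s : Measure Ω) ∂d := by
        refine Finset.sum_congr rfl fun s _ => ?_
        rw [integral_const_mul, integral_integral_swap (f := fun x ω => F x s ω) (hint s)]
    _ = ∫ x, expectation p ν (F x) ∂d := (integral_finsetSum _ fun s _ => hterm s).symm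
    _ ≤ ∫ _, c ∂d := integral_mono (integrable_finsetSum _ fun s _ => hterm s)
        (integrable_const c) hc
    _ = c := by simp

theorem upperExpectation_integral_le (hp : p ∈ stdSimplex ℝ σ) (hQ : Q.Nonempty)
    (hF : ∀ s, Continuous fun z : X × Ω => F z.1 s z.2) {c : ℝ}
    (hc : ∀ x, upperExpectation p Q (F x) ≤ c) :
    upperExpectation p Q (fun s ω => ∫ x, F x s ω ∂d) ≤ c := by
  have := hQ.to_subtype
  refine ciSup_le fun ν => expectation_integral_le hF fun x => ?_
  exact (expectation_le_upperExpectation hp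
    (fun s => (hF s).comp (Continuous.prodMk_right x)) ν.2).trans (hc x)

end Mixture

end Expectation

theorem FiniteOrInterval.isCompact {s : Set ℝ} (hs : FiniteOrInterval s) : IsCompact s := by
  rcases hs.2 with hfin | ⟨l, r, rfl⟩
  exacts [hfin.isCompact, isCompact_Icc]

namespace Game

theorem pi_pure {ι : Type*} [Fintype ι] [DecidableEq ι] {T : ι → Type*} {A : ι → Set ℝ} {n : ι}
    (α : (n : ι) → T n → A n) (s : OppType T n) :
    Measure.pi (fun m : {m : ι // m ≠ n} => (pure α m (s m) : Measure (A m))) =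
      Measure.dirac fun m : {m : ι // m ≠ n} => α m (s m) := by
  rw [← Measure.infinitePi_eq_pi]
  exact Measure.infinitePi_dirac _

variable {ι : Type*} [Fintype ι] [DecidableEq ι] {T : ι → Type*} [∀ n, Fintype (T n)]
  {A : ι → Set ℝ} {k : ℕ} {W : Fin k → Set ℝ} (G : Game ι T A W)

theorem compactSpace_act (G : Game ι T A W) (n : ι) : CompactSpace (A n) :=
  isCompact_iff_compactSpace.1 (G.act_shape n).isCompact

theorem compactSpace_state (G : Game ι T A W) : CompactSpace (State W) :=
  have := fun i => isCompact_iff_compactSpace.1 (G.state_shape i).isCompact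
  Pi.compactSpace

theorem p_mem_stdSimplex (n : ι) (t : T n) : G.p n t ∈ stdSimplex ℝ (OppType T n) :=
  ⟨G.p_nonneg n t, G.p_sum n t⟩

theorem continuous_u_act (n : ι) (t : T n) (s : OppType T n) (ω : State W) :
    Continuous fun x : A n × OppAct A n => G.u n t s x.1 x.2 ω :=
  (G.u_cont n t s).comp (by fun_prop : Continuous fun x : A n × OppAct A n => (x.1, x.2, ω))

theorem continuous_u_state (n : ι) (t : T n) (s : OppType T n) (a : A n) (b : OppAct A n) :
    Continuous (G.u n t s a b) :=
  (G.u_cont n t s).comp (by fun_prop : Continuous fun ω => (a, b, ω))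

section Equilibrium

variable (n : ι) (t : T n) (δ : (m : {m : ι // m ≠ n}) → T m → ProbabilityMeasure (A m))

theorem payoffDist_dirac (a : A n) :
    G.payoffDist n t ⟨Measure.dirac a, inferInstance⟩ δ = G.payoffAct n t a δ := by
  funext s ω
  have hu := G.continuous_u_act n t s ω
  simp only [payoffDist, payoffAct, ProbabilityMeasure.coe_mk, Measure.dirac_prod]
  exact Measure.map_map hu.measurable (by fun_prop)

theorem integral_payoffAct (a : A n) (s : OppType T n) (ω : State W) :
    ∫ x, x ∂(G.payoffAct n t a δ s ω) =
      ∫ b, G.u n t s a b ω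
        ∂(Measure.pi fun m : {m : ι // m ≠ n} => (δ m (s m) : Measure (A m))) := by
  have hu : Continuous fun b => G.u n t s a b ω :=
    (G.continuous_u_act n t s ω).comp (Continuous.prodMk_right a)
  exact integral_map hu.measurable.aemeasurable aestronglyMeasurable_id

theorem integral_payoffDist (d : ProbabilityMeasure (A n)) (s : OppType T n) (ω : State W) :
    ∫ x, x ∂(G.payoffDist n t d δ s ω) =
      ∫ a, ∫ x, x ∂(G.payoffAct n t a δ s ω) ∂(d : Measure (A n)) := by
  have := G.compactSpace_act
  have hu := G.continuous_u_act n t s ω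
  simp only [integral_payoffAct]
  exact (integral_map hu.measurable.aemeasurable aestronglyMeasurable_id).trans
    (integral_prod _ (integrable_of_continuous hu _))

theorem continuous_integral_payoffAct (s : OppType T n) :
    Continuous fun z : A n × State W => ∫ x, x ∂(G.payoffAct n t z.1 δ s z.2) := by
  have := G.compactSpace_act
  have := G.compactSpace_state
  have hu : Continuous fun x : (A n × State W) × OppAct A n => G.u n t s x.1.1 x.2 x.1.2 :=
    (G.u_cont n t s).comp (by fun_prop :
      Continuous fun x : (A n × State W) × OppAct A n => (x.1.1, x.2, x.1.2))
  simpa only [integral_payoffAct, setIntegral_univ] using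
    continuous_parametric_integral_of_continuous
      (μ := Measure.pi fun m : {m : ι // m ≠ n} => (δ m (s m) : Measure (A m))) hu isCompact_univ

theorem satisfaction_payoffDist_le (d : ProbabilityMeasure (A n)) {c : ℝ}
    (hc : ∀ a, G.satisfaction n t (G.payoffAct n t a δ) ≤ c) :
    G.satisfaction n t (G.payoffDist n t d δ) ≤ c := by
  have := G.compactSpace_act n
  have := G.compactSpace_state
  change upperExpectation (G.p n t) (G.Q n t)
    (fun s ω => ∫ x, x ∂(G.payoffDist n t d δ s ω)) ≤ c
  simp only [integral_payoffDist]
  exact upperExpectation_integral_le (G.p_mem_stdSimplex n t) (G.prior_nonempty n t)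
    (G.continuous_integral_payoffAct n t δ) hc

theorem satisfaction_payoffAct_pure (a : A n) (α : (n : ι) → T n → A n) :
    G.satisfaction n t (G.payoffAct n t a fun m => pure α m) =
      G.optPayoff n t a fun m => α m := by
  have h : ∀ s ω, ∫ x, x ∂(G.payoffAct n t a (fun m => pure α m) s ω) =
      G.u n t s a (fun m => α m (s m)) ω := by
    intro s ω
    rw [integral_payoffAct, pi_pure, integral_dirac]
  simp only [satisfaction, h, optPayoff, w, v]

theorem isDistEquilibrium_pure_iff (α : (n : ι) → T n → A n) :
    G.IsDistEquilibrium (pure α) ↔ ∀ n t, α n t ∈ G.bestAct n t fun m => α m := by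
  refine forall₂_congr fun n t => ?_
  have hpure : ∀ a, G.satisfaction n t (G.payoffDist n t ⟨Measure.dirac a, inferInstance⟩
      fun m => pure α m) = G.optPayoff n t a fun m => α m := fun a => by
    rw [payoffDist_dirac, satisfaction_payoffAct_pure]
  have hα : G.satisfaction n t (G.payoffDist n t (pure α n t) fun m => pure α m) =
      G.optPayoff n t (α n t) fun m => α m := hpure _
  rw [hα]
  refine ⟨fun h a => (hpure a).symm.trans_le (h _), fun h d => ?_⟩
  exact G.satisfaction_payoffDist_le n t _ d fun a =>
    (G.satisfaction_payoffAct_pure n t a α).trans_le (h a)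

theorem isActionEquilibrium_pure_iff (α : (n : ι) → T n → A n) :
    G.IsActionEquilibrium (pure α) ↔ ∀ n t, α n t ∈ G.bestAct n t fun m => α m := by
  refine forall₂_congr fun n t => ?_
  simp only [satisfaction_payoffAct_pure]
  change Measure.dirac (α n t) (G.bestAct n t fun m => α m) = 1 ↔ _
  rw [Measure.dirac_apply, Set.indicator_eq_one_iff_mem]

end Equilibrium

section BestResponse

theorem isSubcomplete_bestAct (n : ι) (t : T n) (α : (m : {m : ι // m ≠ n}) → T m → A m) :
    IsSubcomplete (G.bestAct n t α) := by
  have := G.compactSpace_act n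
  have := G.compactSpace_state
  have := (G.act_shape n).1.to_subtype
  have hu : ∀ s, Continuous fun z : A n × State W => G.u n t s z.1 (fun m => α m (s m)) z.2 :=
    fun s => (G.u_cont n t s).comp (by fun_prop :
      Continuous fun z : A n × State W => (z.1, fun m => α m (s m), z.2))
  exact isSubcomplete_argmax
    (continuous_upperExpectation (G.p_mem_stdSimplex n t) (G.prior_nonempty n t) hu)

variable [∀ n, LinearOrder (T n)]

theorem isSubcomplete_univ_profiles (G : Game ι T A W) :
    IsSubcomplete (Set.univ : Set ((n : ι) → T n →o A n)) := by
  have := G.compactSpace_act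
  have := fun n => (G.act_shape n).1.to_subtype
  have huniv : (Set.univ.pi fun n => monotoneSelections fun _ : T n => (Set.univ : Set (A n))) =
      Set.univ := Set.eq_univ_of_forall fun _ _ _ _ => trivial
  rw [← huniv]
  exact IsSubcomplete.pi fun n => IsSubcomplete.monotoneSelections
    (fun _ => isSubcomplete_of_isClosed isClosed_univ Set.univ_nonempty)
    fun _ _ _ _ _ _ _ => ⟨trivial, trivial⟩

theorem bestRespProfile_eq_pi (a : (n : ι) → T n →o A n) :
    G.bestRespProfile a =
      Set.univ.pi fun n => monotoneSelections fun t => G.bestAct n t fun m => a m := by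
  ext a'
  exact Set.mem_univ_pi.symm

/-- The conditions under which best responses increase: strategic complementarities in the
payoff-utility, and priors that are monotone in the opponents' types and, for a lower and a higher
own type, have a common upper bound among the priors of the higher type. -/
structure OptimisticComplementarities (G : Game ι T A W) : Prop where
  mono_state : ∀ n t s a b, Monotone (G.u n t s a b)
  incDiff_own : ∀ n, IncDiff fun (a : A n) (y : T n × OppType T n × OppAct A n × State W) =>
    G.u n y.1 y.2.1 a y.2.2.1 y.2.2.2
  mono_prob : ∀ n ⦃t₁ t₂ : T n⦄, t₁ ≤ t₂ → ∀ f : OppType T n → ℝ, Monotone f →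
    ∑ s, G.p n t₁ s * f s ≤ ∑ s, G.p n t₂ s * f s
  stLE_of_mem_Q : ∀ n t, ∀ ν ∈ G.Q n t, ∀ ⦃s₁ s₂⦄, s₁ ≤ s₂ → StLE (ν s₁) (ν s₂)
  exists_upper_mem_Q : ∀ n ⦃t₁ t₂⦄, t₁ ≤ t₂ → ∀ ν₁ ∈ G.Q n t₁, ∀ ν₂ ∈ G.Q n t₂,
    ∃ ν ∈ G.Q n t₂, (∀ s, StLE (ν₁ s) (ν s)) ∧ ∀ s, StLE (ν₂ s) (ν s)

namespace OptimisticComplementarities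

variable {G} (hG : G.OptimisticComplementarities) {n : ι} {t₁ t₂ : T n}
  {α β : (m : {m : ι // m ≠ n}) → T m →o A m} {ν₁ ν₂ : OppType T n → ProbabilityMeasure (State W)}
include hG

theorem w_mono (t : T n) (a : A n) (α : (m : {m : ι // m ≠ n}) → T m → A m)
    (hν : ∀ s, StLE (ν₁ s) (ν₂ s)) : G.w n t a α ν₁ ≤ G.w n t a α ν₂ := by
  have := G.compactSpace_state
  exact expectation_mono_prior (G.p_nonneg n t) hν (fun s => hG.mono_state n t s a _) le_rfl
    (fun s => G.continuous_u_state n t s a _) fun s => G.continuous_u_state n t s a _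

theorem w_sub_le_w_sub (ht : t₁ ≤ t₂) {a₁ a₂ : A n} (ha : a₁ ≤ a₂) (hαβ : α ≤ β)
    (hν₁ : ∀ ⦃s₁ s₂⦄, s₁ ≤ s₂ → StLE (ν₁ s₁) (ν₁ s₂)) (hν : ∀ s, StLE (ν₁ s) (ν₂ s)) :
    G.w n t₁ a₂ (fun m => α m) ν₁ - G.w n t₁ a₁ (fun m => α m) ν₁ ≤
      G.w n t₂ a₂ (fun m => β m) ν₂ - G.w n t₂ a₁ (fun m => β m) ν₂ := by
  have := G.compactSpace_state
  let gain (t : T n) (γ : (m : {m : ι // m ≠ n}) → T m →o A m) (s : OppType T n) (ω : State W) :=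
    G.u n t s a₂ (fun m => γ m (s m)) ω - G.u n t s a₁ (fun m => γ m (s m)) ω
  have gain_cont : ∀ t γ s, Continuous (gain t γ s) := fun t γ s =>
    (G.continuous_u_state n t s a₂ _).sub (G.continuous_u_state n t s a₁ _)
  have gain_le : ∀ {t t' γ γ' s s' ω ω'}, t ≤ t' → γ ≤ γ' → s ≤ s' → ω ≤ ω' →
      gain t γ s ω ≤ gain t' γ' s' ω' := fun {t t' γ γ' s s' ω ω'} ht hγ hs hω =>
    hG.incDiff_own n ha
      (show (t, s, (fun m => γ m (s m)), ω) ≤ (t', s', (fun m => γ' m (s' m)), ω') from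
        ⟨ht, hs, fun m => ((γ m).monotone (hs m)).trans (hγ m (s' m)), hω⟩)
  have w_sub : ∀ t γ ν, expectation (G.p n t) ν (gain t γ) =
      G.w n t a₂ (fun m => γ m) ν - G.w n t a₁ (fun m => γ m) ν := fun t γ ν =>
    expectation_sub (fun s => G.continuous_u_state n t s a₂ _)
      fun s => G.continuous_u_state n t s a₁ _
  rw [← w_sub, ← w_sub]
  calc expectation (G.p n t₁) ν₁ (gain t₁ α)
      ≤ expectation (G.p n t₂) ν₁ (gain t₁ α) := expectation_mono_weight (hG.mono_prob n ht) hν₁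
        (fun _ _ hx => gain_le le_rfl le_rfl hx.1 hx.2) (gain_cont t₁ α)
    _ ≤ expectation (G.p n t₂) ν₂ (gain t₂ β) := expectation_mono_prior (G.p_nonneg n t₂) hν
        (fun s _ _ hω => gain_le le_rfl le_rfl le_rfl hω)
        (fun s ω => gain_le ht hαβ le_rfl le_rfl) (gain_cont t₁ α) (gain_cont t₂ β)

theorem incDiff_optPayoff (n : ι) :
    IncDiff fun (a : A n) (y : T n × ((m : {m : ι // m ≠ n}) → T m →o A m)) =>
      G.optPayoff n y.1 a fun m => y.2 m := by
  have := G.compactSpace_state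
  have hbdd : ∀ t a (γ : (m : {m : ι // m ≠ n}) → T m →o A m),
      BddAbove (Set.range fun ν : G.Q n t => G.w n t a (fun m => γ m) ν) := fun t a γ =>
    bddAbove_expectation (G.p_mem_stdSimplex n t) fun s => G.continuous_u_state n t s a _
  refine incDiff_iSup (Q := fun y : T n × ((m : {m : ι // m ≠ n}) → T m →o A m) => G.Q n y.1)
    (fun y => G.prior_nonempty n y.1) (fun a y => hbdd y.1 a y.2) ?_
  intro a₁ a₂ ha y₁ y₂ hy ν₁ hν₁ ν₂ hν₂
  obtain ⟨ν, hν, hle₁, hle₂⟩ := hG.exists_upper_mem_Q n hy.1 ν₁ hν₁ ν₂ hν₂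
  exact ⟨ν, hν, hG.w_sub_le_w_sub hy.1 ha hy.2 (hG.stLE_of_mem_Q n y₁.1 ν₁ hν₁) hle₁,
    hG.w_mono y₂.1 a₁ _ hle₂⟩

theorem strongSetLE_bestAct (ht : t₁ ≤ t₂) (hαβ : α ≤ β) :
    StrongSetLE (G.bestAct n t₁ fun m => α m) (G.bestAct n t₂ fun m => β m) :=
  (hG.incDiff_optPayoff n).strongSetLE_argmax (show (t₁, α) ≤ (t₂, β) from ⟨ht, hαβ⟩)

theorem strongSetLE_bestRespProfile {a b : (n : ι) → T n →o A n} (hab : a ≤ b) :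
    StrongSetLE (G.bestRespProfile a) (G.bestRespProfile b) := by
  rw [bestRespProfile_eq_pi, bestRespProfile_eq_pi]
  exact StrongSetLE.pi fun n => StrongSetLE.monotoneSelections fun t =>
    hG.strongSetLE_bestAct le_rfl fun m => hab m

theorem isSubcomplete_bestRespProfile (a : (n : ι) → T n →o A n) :
    IsSubcomplete (G.bestRespProfile a) := by
  rw [bestRespProfile_eq_pi]
  exact IsSubcomplete.pi fun n => IsSubcomplete.monotoneSelections
    (fun t => G.isSubcomplete_bestAct n t _) fun t₁ t₂ ht => hG.strongSetLE_bestAct ht le_rfl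

theorem exists_isLUB_fixedPoints (S : Set G.fixedPoints) : ∃ x, IsLUB S x :=
  letI := G.isSubcomplete_univ_profiles.completeLattice
  Enterprising.exists_isLUB_fixedPoints (F := G.bestRespProfile)
    (fun _ _ hab => hG.strongSetLE_bestRespProfile hab) hG.isSubcomplete_bestRespProfile S

theorem exists_isGLB_fixedPoints (S : Set G.fixedPoints) : ∃ x, IsGLB S x :=
  let ⟨x, hx⟩ := hG.exists_isLUB_fixedPoints (lowerBounds S)
  ⟨x, isLUB_lowerBounds.1 hx⟩

end OptimisticComplementarities

end BestResponse

section Scenarios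

variable {G}

theorem ScenarioB.mem_Q_iff (hB : G.ScenarioB) {n : ι} {t : T n}
    {ν : OppType T n → ProbabilityMeasure (State W)} :
    ν ∈ G.Q n t ↔ ∃ μ, (∀ s, μ ∈ G.prior n t s) ∧ ν = fun _ => μ := by
  rw [Q, hB.2 n t]
  exact ⟨fun ⟨hμ, μ, hν⟩ => ⟨μ, by simpa only [hν] using hμ, hν⟩,
    fun ⟨μ, hμ, hν⟩ => ⟨by simpa only [hν] using hμ, μ, hν⟩⟩

variable [∀ n, LinearOrder (T n)] {n : ι} {t₁ t₂ : T n}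
  {ν₁ ν₂ : OppType T n → ProbabilityMeasure (State W)}

theorem ScenarioA.mem_Q_iff (hA : G.ScenarioA) {t : T n}
    {ν : OppType T n → ProbabilityMeasure (State W)} :
    ν ∈ G.Q n t ↔ (∀ s, ν s ∈ G.prior n t s) ∧ ∀ s₁ s₂, s₁ ≤ s₂ → StLE (ν s₁) (ν s₂) := by
  rw [Q, hA.2 n t]
  rfl

theorem StrategicComplementarities.exists_upper_mem_Q_of_scenarioA
    (hG : G.StrategicComplementarities) (hA : G.ScenarioA) (ht : t₁ ≤ t₂) (hν₁ : ν₁ ∈ G.Q n t₁)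
    (hν₂ : ν₂ ∈ G.Q n t₂) :
    ∃ ν ∈ G.Q n t₂, (∀ s, StLE (ν₁ s) (ν s)) ∧ ∀ s, StLE (ν₂ s) (ν s) := by
  obtain ⟨hprior₁, hmono₁⟩ := hA.mem_Q_iff.1 hν₁
  obtain ⟨hprior₂, hmono₂⟩ := hA.mem_Q_iff.1 hν₂
  choose j hj hjoin using fun s =>
    (hG.mono_prior n t₁ t₂ s ht _ (hprior₁ s) _ (hprior₂ s)).2
  have hmono : ∀ s s', s ≤ s' → StLE (j s) (j s') := fun s s' hs => (hjoin s).2.2 _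
    ((hmono₁ s s' hs).trans (hjoin s').1) ((hmono₂ s s' hs).trans (hjoin s').2.1)
  exact ⟨j, hA.mem_Q_iff.2 ⟨hj, hmono⟩, fun s => (hjoin s).1, fun s => (hjoin s).2.1⟩

theorem StrategicComplementarities.exists_upper_mem_Q_of_scenarioB
    (hG : G.StrategicComplementarities) (hB : G.ScenarioB) (ht : t₁ ≤ t₂) (hν₁ : ν₁ ∈ G.Q n t₁)
    (hν₂ : ν₂ ∈ G.Q n t₂) :
    ∃ ν ∈ G.Q n t₂, (∀ s, StLE (ν₁ s) (ν s)) ∧ ∀ s, StLE (ν₂ s) (ν s) := by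
  rcases isEmpty_or_nonempty (OppType T n) with hempty | ⟨⟨s₀⟩⟩
  · exact ⟨ν₂, hν₂, hempty.elim, hempty.elim⟩
  obtain ⟨μ₁, hμ₁, rfl⟩ := hB.mem_Q_iff.1 hν₁
  obtain ⟨μ₂, hμ₂, rfl⟩ := hB.mem_Q_iff.1 hν₂
  obtain ⟨j, hj, hle₁, hle₂, -⟩ := (hG.mono_prior n t₁ t₂ s₀ ht _ (hμ₁ s₀) _ (hμ₂ s₀)).2
  have hj' : ∀ s, j ∈ G.prior n t₂ s := fun s => hB.1 n t₂ s₀ s ▸ hj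
  exact ⟨fun _ => j, hB.mem_Q_iff.2 ⟨j, hj', rfl⟩, fun _ => hle₁, fun _ => hle₂⟩

theorem StrategicComplementarities.optimisticComplementarities
    (hG : G.StrategicComplementarities) (hAB : G.ScenarioA ∨ G.ScenarioB) :
    G.OptimisticComplementarities where
  mono_state := hG.mono_state
  incDiff_own := hG.incDiff_own
  mono_prob := hG.mono_prob
  stLE_of_mem_Q n t ν hν s₁ s₂ hs := by
    rcases hAB with hA | hB
    · exact (hA.mem_Q_iff.1 hν).2 s₁ s₂ hs
    · obtain ⟨μ, -, rfl⟩ := hB.mem_Q_iff.1 hν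
      exact StLE.refl μ
  exists_upper_mem_Q n t₁ t₂ ht ν₁ hν₁ ν₂ hν₂ := hAB.elim
    (fun hA => hG.exists_upper_mem_Q_of_scenarioA hA ht hν₁ hν₂)
    fun hB => hG.exists_upper_mem_Q_of_scenarioB hB ht hν₁ hν₂

end Scenarios

end Game

end Enterprising

theorem theorem7_general {ι : Type*} [Fintype ι] [DecidableEq ι] {T : ι → Type*}
    [∀ n, Fintype (T n)] [∀ n, LinearOrder (T n)] {A : ι → Set ℝ} {k : ℕ} {W : Fin k → Set ℝ}
    (G : Enterprising.Game ι T A W) (hG : G.OptimisticComplementarities) :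
    G.fixedPoints.Nonempty ∧
    (∀ S : Set G.fixedPoints, (∃ x, IsLUB S x) ∧ (∃ x, IsGLB S x)) ∧
    (∀ a : (n : ι) → T n →o A n,
      (a ∈ G.fixedPoints ↔ G.IsActionEquilibrium (Enterprising.Game.pure fun n => a n)) ∧
      (a ∈ G.fixedPoints ↔ G.IsDistEquilibrium (Enterprising.Game.pure fun n => a n))) ∧
    (∃ a, IsLeast G.fixedPoints a) ∧ (∃ a, IsGreatest G.fixedPoints a) := by
  obtain ⟨least, hleast⟩ := hG.exists_isLUB_fixedPoints ∅
  obtain ⟨greatest, hgreatest⟩ := hG.exists_isGLB_fixedPoints ∅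
  have hbot : IsBot least := isLUB_empty_iff.1 hleast
  have htop : IsTop greatest := isGLB_empty_iff.1 hgreatest
  refine ⟨⟨least, least.2⟩, fun S => ⟨hG.exists_isLUB_fixedPoints S, hG.exists_isGLB_fixedPoints S⟩,
    fun a => ⟨?_, ?_⟩, ⟨least, least.2, fun e he => hbot ⟨e, he⟩⟩,
    ⟨greatest, greatest.2, fun e he => htop ⟨e, he⟩⟩⟩
  · exact (G.isActionEquilibrium_pure_iff fun n => a n).symm
  · exact (G.isDistEquilibrium_pure_iff fun n => a n).symm

theorem theorem7 {ι : Type*} [Fintype ι] [DecidableEq ι] {T : ι → Type*}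
    [∀ n, Fintype (T n)] [∀ n, LinearOrder (T n)] [∀ n, Nonempty (T n)]
    {A : ι → Set ℝ} {k : ℕ} {W : Fin k → Set ℝ}
    (G : Enterprising.Game ι T A W)
    (hG : G.StrategicComplementarities)
    (hAB : G.ScenarioA ∨ G.ScenarioB) :
    -- the fixed points form a nonempty complete lattice in the induced order
    G.fixedPoints.Nonempty ∧
    (∀ S : Set G.fixedPoints, (∃ x, IsLUB S x) ∧ (∃ x, IsGLB S x)) ∧
    -- they are exactly the pure and type-monotone equilibria, in both senses
    (∀ a : (n : ι) → T n →o A n,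
      (a ∈ G.fixedPoints ↔ G.IsActionEquilibrium (Enterprising.Game.pure fun n => a n)) ∧
      (a ∈ G.fixedPoints ↔ G.IsDistEquilibrium (Enterprising.Game.pure fun n => a n))) ∧
    -- there are a smallest and a largest one
    (∃ a, IsLeast G.fixedPoints a) ∧ (∃ a, IsGreatest G.fixedPoints a) :=
  theorem7_general G (hG.optimisticComplementarities hAB)
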